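/- Let $(\Omega,\mathcal F,\mathbb P)$ be a complete probability space carrying a standard one-dimensional Brownian motion $W$, let $\mathbb F=\{\mathcal F_t\}_{t\ge 0}$ be the usual augmentation of the natural filtration of $W$, and let $$\mathcal U=\Big\{\varphi:[0,1]\times\Omega\to\mathbb R \;\Big|\; \varphi \text{ is } \mathbb F\text{-progressively measurable and } \mathbb E\int_0^1|\varphi(t)|^2\,dt<\infty\Big\}.$$ For $x\in\mathbb R$ and $u_1,u_2\in\mathcal U$ consider the one-dimensional state equation $$dX(t)=u_1(t)\,dt+u_2(t)\,dW(t),\quad t\in[0,1],\qquad X(0)=x,$$ and the quadratic functional $$J(x;u_1,u_2)=\mathbb E\Big\{|X(1)|^2+\int_0^1\big[t^2|u_1(t)|^2-|u_2(t)|^2\big]\,dt\Big\},$$ which Player 1 minimizes through $u_1$ and Player 2 maximizes through $u_2$. Define the open-loop lower and upper values, with values in $[-\infty,\infty]$, by $$V^-(x)=\sup_{u_2\in\mathcal U}\inf_{u_1\in\mathcal U}J(x;u_1,u_2),\qquad V^+(x)=\inf_{u_1\in\mathcal U}\sup_{u_2\in\mathcal U}J(x;u_1,u_2),$$ and call $(u_1^*,u_2^*)\in\mathcal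 U\times\mathcal U$ an open-loop saddle point for $x$ if $$J(x;u_1^*,u_2)\le J(x;u_1^*,u_2^*)\le J(x;u_1,u_2^*)\quad\text{for all } u_1,u_2\in\mathcal U.$$ Then: 1. for every $x\in\mathbb R$ both $V^-(x)$ and $V^+(x)$ are finite, with $V^-(x)\ge 0$ and $V^+(x)\le x^2$; 2. for every $x\ne 0$ there is no open-loop saddle point for the initial state $x$. In particular, for this game it is not true that finiteness of the open-loop lower and upper values at an initial state always implies the existence of an open-loop saddle point for that initial state. -/

import Mathlib

open MeasureTheory ProbabilityTheory Filter Topology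
open scoped NNReal ENNReal

namespace SLQGame

variable {Ω : Type*} {mΩ : MeasurableSpace Ω}

section Filtration

/-- On a complete probability space every coordinate of a Brownian motion is measurable. -/
theorem measurable_brownian {P : Measure Ω} [P.IsComplete] {W : ℝ≥0 → Ω → ℝ}
    (hW : IsBrownianReal W P) (t : ℝ≥0) : Measurable (W t) :=
  (hW.aemeasurable t).nullMeasurable.measurable_of_complete

/-- On a complete probability space the `σ`-algebra generated by the null sets consists of
measurable sets. -/
theorem generateFrom_null_le (P : Measure Ω) [P.IsComplete] :
    MeasurableSpace.generateFrom {s : Set Ω | P s = 0} ≤ mΩ :=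
  MeasurableSpace.generateFrom_le fun _ hs => Measure.IsComplete.out' _ hs

/-- The usual augmentation of the natural filtration of `W`: the `σ`-algebra at time `t` is the
intersection over `s > t` of the `σ`-algebras generated by `W r`, `r ≤ s`, and the
`P`-null sets. -/
noncomputable def augmentedFiltration (P : Measure Ω) [P.IsComplete] (W : ℝ≥0 → Ω → ℝ)
    (hW : IsBrownianReal W P) : Filtration ℝ≥0 mΩ :=
  (Filtration.natural W (fun t => (measurable_brownian hW t).stronglyMeasurable) ⊔
    Filtration.const ℝ≥0 (MeasurableSpace.generateFrom {s : Set Ω | P s = 0})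
      (generateFrom_null_le P)).rightCont

end Filtration

section Controls

/-- The squared `L²` norm `𝔼 ∫₀ᵀ |φ(t)|² dt` of a process, with values in `[0, ∞]`.
Time integrals are Lebesgue integrals over a real interval in `[0, ∞)`, where `t.toNNReal` is the
time `t` itself, seen as an element of the index set `ℝ≥0`. -/
noncomputable def energy (P : Measure Ω) (T : ℝ≥0) (φ : ℝ≥0 → Ω → ℝ) : ℝ≥0∞ :=
  ∫⁻ ω, (∫⁻ t in Set.Icc (0 : ℝ) T, ‖φ t.toNNReal ω‖ₑ ^ 2) ∂P

/-- The space of controls on `[0, T]`: progressively measurable processes `φ` with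
`𝔼 ∫₀ᵀ |φ(t)|² dt < ∞`. A process on `[0, T]` is represented by a process on `[0, ∞)` (for instance
its extension by zero); its values after time `T` play no role anywhere. -/
def controls (F : Filtration ℝ≥0 mΩ) (P : Measure Ω) (T : ℝ≥0) : Set (ℝ≥0 → Ω → ℝ) :=
  {φ | IsStronglyProgressive F φ ∧ energy P T φ < ∞}

end Controls

section Ito

/-- A simple (elementary) process `∑ i < n, ξ i · 1_{(t i, t (i + 1)]}` with
`t 0 ≤ t 1 ≤ ⋯` and `ξ i` bounded and measurable with respect to the `σ`-algebra at time `t i`. -/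
structure SimpleProcess (F : Filtration ℝ≥0 mΩ) where
  /-- The number of time intervals. -/
  n : ℕ
  /-- The partition points. -/
  t : ℕ → ℝ≥0
  /-- The coefficient on each time interval. -/
  ξ : ℕ → Ω → ℝ
  mono : Monotone t
  measurable : ∀ i, StronglyMeasurable[F (t i)] (ξ i)
  bounded : ∀ i, ∃ C : ℝ, ∀ ω, |ξ i ω| ≤ C

/-- The process defined by the data of a simple process. -/
noncomputable def SimpleProcess.eval {F : Filtration ℝ≥0 mΩ} (φ : SimpleProcess F)
    (s : ℝ≥0) (ω : Ω) : ℝ :=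
  ∑ i ∈ Finset.range φ.n, (Set.Ioc (φ.t i) (φ.t (i + 1))).indicator (fun _ => φ.ξ i ω) s

/-- The elementary stochastic integral `∫₀ᵀ φ dW` of a simple process. -/
noncomputable def SimpleProcess.integral {F : Filtration ℝ≥0 mΩ} (φ : SimpleProcess F)
    (W : ℝ≥0 → Ω → ℝ) (T : ℝ≥0) (ω : Ω) : ℝ :=
  ∑ i ∈ Finset.range φ.n, φ.ξ i ω * (W (min (φ.t (i + 1)) T) ω - W (min (φ.t i) T) ω)

/-- `I` is (a version of) the Itô integral `∫₀ᵀ u dW`: it is the limit in `L²(Ω)` of the elementary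
integrals of simple processes that converge to `u` in `L²([0, T] × Ω)`. -/
def IsItoIntegral (F : Filtration ℝ≥0 mΩ) (P : Measure Ω) (W : ℝ≥0 → Ω → ℝ)
    (u : ℝ≥0 → Ω → ℝ) (T : ℝ≥0) (I : Ω → ℝ) : Prop :=
  MemLp I 2 P ∧ ∃ φ : ℕ → SimpleProcess F,
    Tendsto (fun k => energy P T (fun s ω => (φ k).eval s ω - u s ω)) atTop (𝓝 0) ∧
    Tendsto (fun k => eLpNorm (fun ω => (φ k).integral W T ω - I ω) 2 P) atTop (𝓝 0)

open Classical in
/-- The Itô integral `∫₀ᵀ u dW`, as a random variable. For a Brownian motion `W` and a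
square-integrable progressively measurable `u` it exists and is unique up to a null set; outside
that class the value `0` is a convention. -/
noncomputable def itoIntegral (F : Filtration ℝ≥0 mΩ) (P : Measure Ω) (W : ℝ≥0 → Ω → ℝ)
    (u : ℝ≥0 → Ω → ℝ) (T : ℝ≥0) : Ω → ℝ :=
  if h : ∃ I : Ω → ℝ, IsItoIntegral F P W u T I then h.choose else 0

end Ito

section Game

/-- The state process of `dX(t) = u₁(t) dt + u₂(t) dW(t)`, `X(0) = x`, that is,
`X(t) = x + ∫₀ᵗ u₁(s) ds + ∫₀ᵗ u₂(s) dW(s)`, where each `X(t)` is determined up to a null set. -/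
noncomputable def state (F : Filtration ℝ≥0 mΩ) (P : Measure Ω) (W : ℝ≥0 → Ω → ℝ)
    (x : ℝ) (u₁ u₂ : ℝ≥0 → Ω → ℝ) (t : ℝ≥0) (ω : Ω) : ℝ :=
  x + (∫ s in (0 : ℝ)..t, u₁ s.toNNReal ω) + itoIntegral F P W u₂ t ω

/-- The space of controls of either player: processes on `[0, 1]` that are square-integrable and
progressively measurable for the augmented filtration of the Brownian motion `W`. -/
def controlSpace (P : Measure Ω) [P.IsComplete] (W : ℝ≥0 → Ω → ℝ) (hW : IsBrownianReal W P) :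
    Set (ℝ≥0 → Ω → ℝ) :=
  controls (augmentedFiltration P W hW) P 1

/-- The quadratic functional
`J(x; u₁, u₂) = 𝔼 { |X(1)|² + ∫₀¹ [t² |u₁(t)|² - |u₂(t)|²] dt }`. -/
noncomputable def cost (P : Measure Ω) [P.IsComplete] (W : ℝ≥0 → Ω → ℝ)
    (hW : IsBrownianReal W P) (x : ℝ) (u₁ u₂ : ℝ≥0 → Ω → ℝ) : ℝ :=
  ∫ ω, (|state (augmentedFiltration P W hW) P W x u₁ u₂ 1 ω| ^ 2 +
    ∫ t in (0 : ℝ)..1, (t ^ 2 * |u₁ t.toNNReal ω| ^ 2 - |u₂ t.toNNReal ω| ^ 2)) ∂P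

/-- The open-loop lower value `V⁻(x) = sup_{u₂} inf_{u₁} J(x; u₁, u₂)`. -/
noncomputable def lowerValue (P : Measure Ω) [P.IsComplete] (W : ℝ≥0 → Ω → ℝ)
    (hW : IsBrownianReal W P) (x : ℝ) : EReal :=
  ⨆ u₂ ∈ controlSpace P W hW, ⨅ u₁ ∈ controlSpace P W hW, (cost P W hW x u₁ u₂ : EReal)

/-- The open-loop upper value `V⁺(x) = inf_{u₁} sup_{u₂} J(x; u₁, u₂)`. -/
noncomputable def upperValue (P : Measure Ω) [P.IsComplete] (W : ℝ≥0 → Ω → ℝ)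
    (hW : IsBrownianReal W P) (x : ℝ) : EReal :=
  ⨅ u₁ ∈ controlSpace P W hW, ⨆ u₂ ∈ controlSpace P W hW, (cost P W hW x u₁ u₂ : EReal)

/-- `(u₁, u₂)` is an open-loop saddle point for the initial state `x`. -/
def IsOpenLoopSaddlePoint (P : Measure Ω) [P.IsComplete] (W : ℝ≥0 → Ω → ℝ)
    (hW : IsBrownianReal W P) (x : ℝ) (u₁ u₂ : ℝ≥0 → Ω → ℝ) : Prop :=
  u₁ ∈ controlSpace P W hW ∧ u₂ ∈ controlSpace P W hW ∧
    ∀ v₁ ∈ controlSpace P W hW, ∀ v₂ ∈ controlSpace P W hW,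
      cost P W hW x u₁ v₂ ≤ cost P W hW x u₁ u₂ ∧ cost P W hW x u₁ u₂ ≤ cost P W hW x v₁ u₂

/-- An extended real number is finite. -/
def IsFiniteValue (v : EReal) : Prop := v ≠ ⊥ ∧ v ≠ ⊤

end Game

end SLQGame

namespace SLQGame

section Increments

variable {Ω : Type*} {mΩ : MeasurableSpace Ω} {P : Measure Ω} {W : ℝ≥0 → Ω → ℝ}

theorem indep_sup_null {m₁ m₂ : MeasurableSpace Ω} (h : Indep m₁ m₂ P) :
    Indep (m₁ ⊔ MeasurableSpace.generateFrom {s : Set Ω | P s = 0}) m₂ P := by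
  have hle : m₁ ⊔ MeasurableSpace.generateFrom {s : Set Ω | P s = 0} ≤
      eventuallyMeasurableSpace m₁ (ae P) := by
    refine sup_le (le_eventuallyMeasurableSpace (m := m₁) (l := ae P)) (MeasurableSpace.generateFrom_le ?_)
    intro s hs
    exact ⟨∅, @MeasurableSet.empty Ω m₁, ae_eq_empty.2 hs⟩
  rw [Indep_iff] at h ⊢
  rintro s t hs ht
  obtain ⟨s', hs', hss'⟩ := hle s hs
  rw [measure_congr hss', measure_congr (hss'.inter (ae_eq_refl t)), h s' t hs' ht]

theorem augmentedFiltration_le_of_lt [P.IsComplete] (hW : IsBrownianReal W P) {s r : ℝ≥0}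
    (hsr : s < r) :
    augmentedFiltration P W hW s ≤
      Filtration.natural W (fun t => (measurable_brownian hW t).stronglyMeasurable) r ⊔
        MeasurableSpace.generateFrom {s : Set Ω | P s = 0} := by
  rw [augmentedFiltration, Filtration.rightCont_eq]
  exact iInf₂_le r hsr

theorem le_augmentedFiltration [P.IsComplete] (hW : IsBrownianReal W P) :
    Filtration.natural W (fun t => (measurable_brownian hW t).stronglyMeasurable) ≤
      augmentedFiltration P W hW := by
  rw [augmentedFiltration]
  exact le_sup_left.trans (Filtration.le_rightCont _)

theorem stronglyMeasurable_brownian [P.IsComplete] (hW : IsBrownianReal W P) {s t : ℝ≥0}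
    (hst : s ≤ t) : StronglyMeasurable[augmentedFiltration P W hW t] (W s) :=
  (Filtration.stronglyAdapted_natural
    (fun t => (measurable_brownian hW t).stronglyMeasurable) s).mono
    ((le_augmentedFiltration hW s).trans ((augmentedFiltration P W hW).mono hst))

theorem indepFun_increment_of_lt [P.IsComplete] (hW : IsBrownianReal W P)
    {s r t : ℝ≥0} (hsr : s < r) (hrt : r ≤ t) {ξ : Ω → ℝ}
    (hξ : StronglyMeasurable[augmentedFiltration P W hW s] ξ) :
    IndepFun ξ (fun ω => W t ω - W r ω) P := by
  have h1 := hW.indepFun_shift r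
  have hev : Measurable (fun f : ℝ≥0 → ℝ => f (t - r)) := measurable_pi_apply _
  have h2 : IndepFun (fun ω (t : Set.Iic r) ↦ W t ω) (fun ω => W t ω - W r ω) P := by
    have := h1.symm.comp (φ := id) (ψ := fun f : ℝ≥0 → ℝ => f (t - r)) measurable_id
      hev
    simpa [Function.comp_def, add_tsub_cancel_of_le hrt] using this
  rw [IndepFun_iff_Indep] at h2 ⊢
  refine indep_of_indep_of_le_left (indep_sup_null h2) ?_
  refine hξ.measurable.comap_le.trans ((augmentedFiltration_le_of_lt hW hsr).trans ?_)
  rw [Filtration.natural_eq_comap]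

theorem memLp_brownian (hW : IsBrownianReal W P) (t : ℝ≥0) : MemLp (W t) 2 P :=
  (hW.isGaussianProcess.hasGaussianLaw_eval t).memLp_two

theorem memLp_increment (hW : IsBrownianReal W P) (s t : ℝ≥0) :
    MemLp (fun ω => W t ω - W s ω) 2 P :=
  (memLp_brownian hW t).sub (memLp_brownian hW s)

theorem integral_increment (hW : IsBrownianReal W P) (s t : ℝ≥0) :
    ∫ ω, (W t ω - W s ω) ∂P = 0 := by
  rw [integral_sub (hW.integrable_eval t) (hW.integrable_eval s), hW.integral_eval,
    hW.integral_eval, sub_zero]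

theorem integral_increment_sq (hW : IsBrownianReal W P) {s t : ℝ≥0} (hst : s ≤ t) :
    ∫ ω, (W t ω - W s ω) ^ 2 ∂P = t - s := by
  have hlaw := hW.hasLaw_sub t s
  have h := hlaw.variance_eq
  rw [variance_id_gaussianReal, variance_of_integral_eq_zero hlaw.aemeasurable
    (by simpa using integral_increment hW s t)] at h
  simp only [Pi.sub_apply] at h
  rw [h]
  exact (Real.dist_eq _ _).trans (abs_of_nonneg (sub_nonneg.2 (by exact_mod_cast hst)))

theorem abs_integral_mul_le_of_pos {f g : Ω → ℝ} (hf : MemLp f 2 P) (hg : MemLp g 2 P) {δ : ℝ}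
    (hδ : 0 < δ) :
    |∫ ω, f ω * g ω ∂P| ≤ (δ * ∫ ω, f ω ^ 2 ∂P) + δ⁻¹ * ∫ ω, g ω ^ 2 ∂P := by
  have h1 := hf.integrable_sq
  have h2 := hg.integrable_sq
  rw [← integral_const_mul, ← integral_const_mul,
    ← integral_add (h1.const_mul _) (h2.const_mul _)]
  refine (abs_integral_le_integral_abs).trans
    (integral_mono (hf.integrable_mul hg).abs ((h1.const_mul _).add (h2.const_mul _)) fun ω => ?_)
  have h3 : δ * f ω ^ 2 + δ⁻¹ * g ω ^ 2 - 2 * (|f ω| * |g ω|) =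
      δ⁻¹ * (δ * |f ω| - |g ω|) ^ 2 := by
    rw [← sq_abs (f ω), ← sq_abs (g ω)]
    field_simp
    ring
  have h4 : 0 ≤ δ⁻¹ * (δ * |f ω| - |g ω|) ^ 2 := by positivity
  have h5 : 0 ≤ |f ω| * |g ω| := by positivity
  simp only [abs_mul]
  linarith

theorem eq_zero_of_abs_le_mul {a C d : ℝ} (hd : 0 < d)
    (h : ∀ δ : ℝ, 0 < δ → δ < d → |a| ≤ δ * C) : a = 0 := by
  have hlim : Tendsto (fun δ : ℝ => δ * C) (𝓝[>] 0) (𝓝 0) := by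
    have : Tendsto (fun δ : ℝ => δ * C) (𝓝 0) (𝓝 (0 * C)) := by
      exact (continuous_id.mul continuous_const).tendsto 0
    rw [zero_mul] at this
    exact this.mono_left nhdsWithin_le_nhds
  have : |a| ≤ 0 := ge_of_tendsto hlim (by
    filter_upwards [Ioo_mem_nhdsGT hd] with δ hδ using h δ hδ.1 hδ.2)
  exact abs_eq_zero.1 (le_antisymm this (abs_nonneg a))

theorem exists_time_between {s t : ℝ≥0} {δ : ℝ} (hδ : 0 < δ)
    (hδt : δ < √((t : ℝ) - s)) : ∃ r : ℝ≥0, s < r ∧ r ≤ t ∧ (r : ℝ) - s = δ ^ 2 := by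
  have h2 : δ ^ 2 < t - s := (Real.lt_sqrt hδ.le).1 hδt
  have h0 : 0 < δ ^ 2 := by positivity
  have h1 : ((Real.toNNReal (δ ^ 2) : ℝ≥0) : ℝ) = δ ^ 2 := Real.coe_toNNReal _ h0.le
  refine ⟨s + Real.toNNReal (δ ^ 2), ?_, ?_, ?_⟩
  · exact lt_add_of_pos_right s (Real.toNNReal_pos.2 h0)
  · rw [← NNReal.coe_le_coe]
    push_cast
    rw [h1]
    linarith
  · push_cast
    rw [h1]
    ring

theorem integral_mul_increment [P.IsComplete] (hW : IsBrownianReal W P)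
    {s t : ℝ≥0} (hst : s ≤ t) {ξ : Ω → ℝ}
    (hξ : StronglyMeasurable[augmentedFiltration P W hW s] ξ) (hξ2 : MemLp ξ 2 P) :
    ∫ ω, ξ ω * (W t ω - W s ω) ∂P = 0 := by
  rcases hst.eq_or_lt with rfl | hst
  · simp
  have hd : 0 < √((t : ℝ) - s) := Real.sqrt_pos.2 (sub_pos.2 (by exact_mod_cast hst))
  refine eq_zero_of_abs_le_mul (C := (∫ ω, ξ ω ^ 2 ∂P) + 1) hd fun δ hδ hδt => ?_
  obtain ⟨r, hsr, hrt, hr⟩ := exists_time_between hδ hδt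
  have h1 : ∫ ω, ξ ω * (W t ω - W r ω) ∂P = 0 := by
    rw [(indepFun_increment_of_lt hW hsr hrt hξ).integral_fun_mul_eq_mul_integral
      hξ2.aestronglyMeasurable (memLp_increment hW r t).aestronglyMeasurable,
      integral_increment hW, mul_zero]
  have h2 : ∫ ω, ξ ω * (W t ω - W s ω) ∂P = ∫ ω, ξ ω * (W r ω - W s ω) ∂P := by
    have := integral_add (hξ2.integrable_mul (memLp_increment hW r t))
      (hξ2.integrable_mul (memLp_increment hW s r))
    simp only [Pi.mul_apply] at this
    rw [h1, zero_add] at this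
    rw [← this]
    congr 1 with ω
    ring
  rw [h2]
  refine (abs_integral_mul_le_of_pos hξ2 (memLp_increment hW s r) hδ).trans (le_of_eq ?_)
  rw [integral_increment_sq hW hsr.le, hr]
  field_simp

theorem integral_sq_mul_increment_sq [P.IsComplete] [IsProbabilityMeasure P]
    (hW : IsBrownianReal W P) {s t : ℝ≥0} (hst : s ≤ t) {ξ : Ω → ℝ}
    (hξ : StronglyMeasurable[augmentedFiltration P W hW s] ξ) {C : ℝ} (hC : ∀ ω, |ξ ω| ≤ C) :
    ∫ ω, (ξ ω * (W t ω - W s ω)) ^ 2 ∂P = (t - s) * ∫ ω, ξ ω ^ 2 ∂P := by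
  rcases hst.eq_or_lt with rfl | hst
  · simp
  have hξm : AEStronglyMeasurable ξ P :=
    (hξ.mono ((augmentedFiltration P W hW).le s)).aestronglyMeasurable
  have hξ2 : MemLp ξ 2 P := MemLp.of_bound hξm C (ae_of_all _ hC)
  have hmul : ∀ f : Ω → ℝ, MemLp f 2 P → MemLp (fun ω => ξ ω * f ω) 2 P := fun f hf =>
    hf.of_le_mul (c := C) (hξm.mul hf.aestronglyMeasurable) (ae_of_all _ fun ω => by
      rw [norm_mul]; exact mul_le_mul_of_nonneg_right (hC ω) (norm_nonneg _))
  have hd : 0 < √((t : ℝ) - s) := Real.sqrt_pos.2 (sub_pos.2 (by exact_mod_cast hst))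
  refine sub_eq_zero.1 (eq_zero_of_abs_le_mul
    (C := √((t : ℝ) - s) * (C ^ 2 + ∫ ω, ξ ω ^ 2 ∂P)) hd fun δ hδ hδt => ?_)
  obtain ⟨r, hsr, hrt, hr⟩ := exists_time_between hδ hδt
  have hD1 := memLp_increment hW r t
  have hD2 := memLp_increment hW s r
  have h1 : ∫ ω, (ξ ω * (W t ω - W r ω)) ^ 2 ∂P = (t - r) * ∫ ω, ξ ω ^ 2 ∂P := by
    have hind := (indepFun_increment_of_lt hW hsr hrt hξ).comp (φ := fun x : ℝ => x ^ 2)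
      (ψ := fun x : ℝ => x ^ 2) (by fun_prop) (by fun_prop)
    have := hind.integral_mul_eq_mul_integral hξ2.integrable_sq.aestronglyMeasurable
      hD1.integrable_sq.aestronglyMeasurable
    simp only [Pi.mul_apply, Function.comp_apply] at this
    simp only [mul_pow]
    rw [this, integral_increment_sq hW hrt, mul_comm]
  have h2 : ∫ ω, ξ ω * (ξ ω * (W r ω - W s ω)) * (W t ω - W r ω) ∂P = 0 := by
    have hξr := hξ.mono ((augmentedFiltration P W hW).mono hsr.le)
    exact integral_mul_increment hW hrt (hξr.mul (hξr.mul
      ((stronglyMeasurable_brownian hW le_rfl).sub (stronglyMeasurable_brownian hW hsr.le))))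
      (hmul _ (hmul _ hD2))
  have h3 : ∫ ω, (ξ ω * (W r ω - W s ω)) ^ 2 ∂P ≤ δ ^ 2 * C ^ 2 := by
    calc ∫ ω, (ξ ω * (W r ω - W s ω)) ^ 2 ∂P ≤ ∫ ω, C ^ 2 * (W r ω - W s ω) ^ 2 ∂P := by
          refine integral_mono (hmul _ hD2).integrable_sq (hD2.integrable_sq.const_mul _)
            fun ω => ?_
          simp only [mul_pow]
          refine mul_le_mul_of_nonneg_right ?_ (sq_nonneg _)
          rw [← sq_abs]
          exact pow_le_pow_left₀ (abs_nonneg _) (hC ω) 2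
      _ = δ ^ 2 * C ^ 2 := by
          rw [integral_const_mul, integral_increment_sq hW hsr.le, hr, mul_comm]
  have h3' : 0 ≤ ∫ ω, (ξ ω * (W r ω - W s ω)) ^ 2 ∂P := integral_nonneg fun ω => sq_nonneg _
  have h4 : ∫ ω, (ξ ω * (W t ω - W s ω)) ^ 2 ∂P =
      (t - r) * (∫ ω, ξ ω ^ 2 ∂P) + ∫ ω, (ξ ω * (W r ω - W s ω)) ^ 2 ∂P := by
    have e : ∀ ω, (ξ ω * (W t ω - W s ω)) ^ 2 = (ξ ω * (W t ω - W r ω)) ^ 2 +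
        2 * (ξ ω * (ξ ω * (W r ω - W s ω)) * (W t ω - W r ω)) +
        (ξ ω * (W r ω - W s ω)) ^ 2 := fun ω => by ring
    have i2 : Integrable (fun ω => ξ ω * (ξ ω * (W r ω - W s ω)) * (W t ω - W r ω)) P :=
      (hmul _ (hmul _ hD2)).integrable_mul hD1
    have i1 := (hmul _ hD1).integrable_sq
    have i12 : Integrable (fun ω => (ξ ω * (W t ω - W r ω)) ^ 2 +
        2 * (ξ ω * (ξ ω * (W r ω - W s ω)) * (W t ω - W r ω))) P := i1.add (i2.const_mul 2)
    simp only [e]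
    rw [integral_add i12 (hmul _ hD2).integrable_sq,
      integral_add i1 (i2.const_mul 2), integral_const_mul, h1, h2]
    ring
  have h5 : 0 ≤ ∫ ω, ξ ω ^ 2 ∂P := integral_nonneg fun ω => sq_nonneg _
  have h6 : δ ^ 2 ≤ δ * √((t : ℝ) - s) := by nlinarith
  have h7 : ∫ ω, (ξ ω * (W t ω - W s ω)) ^ 2 ∂P - (t - s) * ∫ ω, ξ ω ^ 2 ∂P =
      ∫ ω, (ξ ω * (W r ω - W s ω)) ^ 2 ∂P - δ ^ 2 * ∫ ω, ξ ω ^ 2 ∂P := by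
    rw [h4, ← hr]
    ring
  have h8 := mul_le_mul_of_nonneg_right h6 (add_nonneg (sq_nonneg C) h5)
  have h9 : 0 ≤ δ ^ 2 * ∫ ω, ξ ω ^ 2 ∂P := mul_nonneg (sq_nonneg _) h5
  have h10 : 0 ≤ δ ^ 2 * C ^ 2 := by positivity
  rw [h7, abs_le]
  constructor <;> nlinarith

end Increments

section SimpleIntegral

variable {Ω : Type*} {mΩ : MeasurableSpace Ω} {P : Measure Ω} {W : ℝ≥0 → Ω → ℝ}

namespace SimpleProcess

theorem memLp_coeff [IsFiniteMeasure P] {F : Filtration ℝ≥0 mΩ} (φ : SimpleProcess F) (i : ℕ) :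
    MemLp (φ.ξ i) 2 P := by
  obtain ⟨C, hC⟩ := φ.bounded i
  exact MemLp.of_bound ((φ.measurable i).mono (F.le _)).aestronglyMeasurable C (ae_of_all _ hC)

theorem memLp_coeff_mul [IsFiniteMeasure P] {F : Filtration ℝ≥0 mΩ} (φ : SimpleProcess F) (i : ℕ)
    {f : Ω → ℝ} (hf : MemLp f 2 P) : MemLp (fun ω => φ.ξ i ω * f ω) 2 P := by
  obtain ⟨C, hC⟩ := φ.bounded i
  exact hf.of_le_mul (c := C) ((φ.memLp_coeff i).aestronglyMeasurable.mul hf.aestronglyMeasurable)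
    (ae_of_all _ fun ω => by
      rw [norm_mul]; exact mul_le_mul_of_nonneg_right (hC ω) (norm_nonneg _))

variable [P.IsComplete] {hW : IsBrownianReal W P}

theorem integral_mul_stopped_increment (φ : SimpleProcess (augmentedFiltration P W hW)) (i : ℕ)
    (T : ℝ≥0) {η : Ω → ℝ} (hη : StronglyMeasurable[augmentedFiltration P W hW (φ.t i)] η)
    (hη2 : MemLp η 2 P) :
    ∫ ω, η ω * (W (min (φ.t (i + 1)) T) ω - W (min (φ.t i) T) ω) ∂P = 0 := by
  rcases le_total (φ.t i) T with h | h
  · rw [min_eq_left h]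
    exact integral_mul_increment hW (le_min (φ.mono i.le_succ) h) hη hη2
  · simp [min_eq_right h, min_eq_right (h.trans (φ.mono i.le_succ))]

variable [IsProbabilityMeasure P]

theorem integral_sq_stopped_increment (φ : SimpleProcess (augmentedFiltration P W hW)) (i : ℕ)
    (T : ℝ≥0) :
    ∫ ω, (φ.ξ i ω * (W (min (φ.t (i + 1)) T) ω - W (min (φ.t i) T) ω)) ^ 2 ∂P =
      ((min (φ.t (i + 1)) T : ℝ≥0) - (min (φ.t i) T : ℝ≥0)) * ∫ ω, φ.ξ i ω ^ 2 ∂P := by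
  rcases le_total (φ.t i) T with h | h
  · rw [min_eq_left h]
    obtain ⟨C, hC⟩ := φ.bounded i
    exact integral_sq_mul_increment_sq hW (le_min (φ.mono i.le_succ) h) (φ.measurable i) hC
  · simp [min_eq_right h, min_eq_right (h.trans (φ.mono i.le_succ))]

theorem partial_integral_properties (φ : SimpleProcess (augmentedFiltration P W hW)) (T : ℝ≥0)
    (n : ℕ) :
    let S := fun ω => ∑ i ∈ Finset.range n,
      φ.ξ i ω * (W (min (φ.t (i + 1)) T) ω - W (min (φ.t i) T) ω)
    StronglyMeasurable[augmentedFiltration P W hW (φ.t n)] S ∧ MemLp S 2 P ∧ ∫ ω, S ω ∂P = 0 ∧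
      ∫ ω, S ω ^ 2 ∂P = ∑ i ∈ Finset.range n,
        ((min (φ.t (i + 1)) T : ℝ≥0) - (min (φ.t i) T : ℝ≥0)) * ∫ ω, φ.ξ i ω ^ 2 ∂P := by
  induction n with
  | zero =>
    simp only [Finset.range_zero, Finset.sum_empty]
    exact ⟨@stronglyMeasurable_const _ _ (augmentedFiltration P W hW (φ.t 0)) _ _,
      MemLp.zero', by simp, by simp⟩
  | succ n ih =>
    obtain ⟨h1, h2, h3, h4⟩ := ih
    simp only [Finset.sum_range_succ]
    set S := fun ω => ∑ i ∈ Finset.range n,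
      φ.ξ i ω * (W (min (φ.t (i + 1)) T) ω - W (min (φ.t i) T) ω) with hS
    set D := fun ω => W (min (φ.t (n + 1)) T) ω - W (min (φ.t n) T) ω with hD
    have hmono := (augmentedFiltration P W hW).mono (φ.mono n.le_succ)
    have hD2 : MemLp D 2 P := memLp_increment hW _ _
    have hξD := φ.memLp_coeff_mul n hD2
    have hSξ : MemLp (fun ω => φ.ξ n ω * S ω) 2 P := φ.memLp_coeff_mul n h2
    have hcross : ∫ ω, (φ.ξ n ω * S ω) * D ω ∂P = 0 :=
      φ.integral_mul_stopped_increment n T ((φ.measurable n).mul h1) hSξ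
    refine ⟨(h1.mono hmono).add (((φ.measurable n).mono hmono).mul
      ((stronglyMeasurable_brownian hW (min_le_left _ _)).sub
        (stronglyMeasurable_brownian hW ((min_le_left _ _).trans (φ.mono n.le_succ))))),
      h2.add hξD, ?_, ?_⟩
    · rw [integral_add (h2.integrable one_le_two) (hξD.integrable one_le_two), h3,
        φ.integral_mul_stopped_increment n T (φ.measurable n) (φ.memLp_coeff n), add_zero]
    · have e : ∀ ω, (S ω + φ.ξ n ω * D ω) ^ 2 = S ω ^ 2 + 2 * ((φ.ξ n ω * S ω) * D ω) +
          (φ.ξ n ω * D ω) ^ 2 := fun ω => by ring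
      have i2 : Integrable (fun ω => 2 * ((φ.ξ n ω * S ω) * D ω)) P :=
        (hSξ.integrable_mul hD2).const_mul 2
      have i12 : Integrable (fun ω => S ω ^ 2 + 2 * ((φ.ξ n ω * S ω) * D ω)) P :=
        h2.integrable_sq.add i2
      calc ∫ ω, (S ω + φ.ξ n ω * D ω) ^ 2 ∂P
          = ∫ ω, S ω ^ 2 + 2 * ((φ.ξ n ω * S ω) * D ω) + (φ.ξ n ω * D ω) ^ 2 ∂P := by
            simp only [e]
        _ = _ := by
            rw [integral_add i12 hξD.integrable_sq, integral_add h2.integrable_sq i2,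
              integral_const_mul, hcross, h4, φ.integral_sq_stopped_increment n T, mul_zero,
              add_zero]

theorem memLp_integral (φ : SimpleProcess (augmentedFiltration P W hW)) (T : ℝ≥0) :
    MemLp (φ.integral W T) 2 P :=
  (φ.partial_integral_properties T φ.n).2.1

theorem integral_integral_eq_zero (φ : SimpleProcess (augmentedFiltration P W hW)) (T : ℝ≥0) :
    ∫ ω, φ.integral W T ω ∂P = 0 :=
  (φ.partial_integral_properties T φ.n).2.2.1

theorem enorm_sum_indicator_sq {t : ℕ → ℝ≥0} (ht : Monotone t) (c : ℕ → ℝ) (n : ℕ) (s : ℝ≥0) :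
    ‖∑ i ∈ Finset.range n, (Set.Ioc (t i) (t (i + 1))).indicator (fun _ => c i) s‖ₑ ^ 2 =
      ∑ i ∈ Finset.range n, (Set.Ioc (t i) (t (i + 1))).indicator (fun _ => ‖c i‖ₑ ^ 2) s := by
  induction n with
  | zero => simp
  | succ n ih =>
    rw [Finset.sum_range_succ, Finset.sum_range_succ]
    by_cases hs : s ∈ Set.Ioc (t n) (t (n + 1))
    · have hout : ∀ i ∈ Finset.range n, s ∉ Set.Ioc (t i) (t (i + 1)) := fun i hi hmem =>
        absurd (hmem.2.trans (ht (Finset.mem_range.1 hi))) (not_le.2 hs.1)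
      rw [Finset.sum_eq_zero fun i hi => Set.indicator_of_notMem (hout i hi) _,
        Finset.sum_eq_zero fun i hi => Set.indicator_of_notMem (hout i hi) _]
      simp [hs]
    · simp [hs, ih]

theorem lintegral_indicator_Ioc_toNNReal {a b T : ℝ≥0} (c : ℝ≥0∞) :
    ∫⁻ s in Set.Icc (0 : ℝ) T, (Set.Ioc a b).indicator (fun _ => c) s.toNNReal =
      c * ENNReal.ofReal ((min b T : ℝ≥0) - (min a T : ℝ≥0)) := by
  have h : ∀ s : ℝ, (Set.Ioc a b).indicator (fun _ => c) s.toNNReal =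
      (Real.toNNReal ⁻¹' Set.Ioc a b).indicator (fun _ => c) s := fun s => rfl
  have hm : MeasurableSet (Real.toNNReal ⁻¹' Set.Ioc a b) :=
    measurable_real_toNNReal measurableSet_Ioc
  have hset : Real.toNNReal ⁻¹' Set.Ioc a b ∩ Set.Icc (0 : ℝ) T =
      Set.Ioc ((min a T : ℝ≥0) : ℝ) ((min b T : ℝ≥0) : ℝ) := by
    ext s
    simp only [Set.mem_inter_iff, Set.mem_preimage, Set.mem_Ioc, Set.mem_Icc, NNReal.coe_min,
      min_lt_iff, le_min_iff, Real.lt_toNNReal_iff_coe_lt, Real.toNNReal_le_iff_le_coe]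
    have := a.coe_nonneg
    constructor
    · rintro ⟨⟨h1, h2⟩, h3, h4⟩
      exact ⟨Or.inl h1, h2, h4⟩
    · rintro ⟨h1 | h1, h2, h3⟩
      · exact ⟨⟨h1, h2⟩, by linarith, h3⟩
      · linarith
  simp only [h]
  rw [lintegral_indicator hm, lintegral_const, Measure.restrict_restrict hm, hset,
    Measure.restrict_apply_univ, Real.volume_Ioc]

theorem energy_eval (φ : SimpleProcess (augmentedFiltration P W hW)) (T : ℝ≥0) :
    energy P T φ.eval = eLpNorm (φ.integral W T) 2 P ^ 2 := by
  have hnn : ∀ i, (0 : ℝ) ≤ (min (φ.t (i + 1)) T : ℝ≥0) - (min (φ.t i) T : ℝ≥0) := fun i =>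
    sub_nonneg.2 (by exact_mod_cast min_le_min_right T (φ.mono i.le_succ))
  have hsq : ∀ f : Ω → ℝ, MemLp f 2 P →
      ∫⁻ ω, ‖f ω‖ₑ ^ 2 ∂P = ENNReal.ofReal (∫ ω, f ω ^ 2 ∂P) := fun f hf => by
    rw [ofReal_integral_eq_lintegral_ofReal hf.integrable_sq (ae_of_all _ fun ω => sq_nonneg _)]
    congr 1 with ω
    rw [← sq_abs, ENNReal.ofReal_pow (abs_nonneg _), ← Real.norm_eq_abs, ofReal_norm]
  have hL : eLpNorm (φ.integral W T) 2 P ^ 2 = ∫⁻ ω, ‖φ.integral W T ω‖ₑ ^ 2 ∂P := by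
    simpa using eLpNorm_nnreal_pow_eq_lintegral (f := φ.integral W T) (μ := P)
      (p := 2) two_ne_zero
  rw [hL, hsq _ (φ.memLp_integral T)]
  have h4 : ∫ ω, φ.integral W T ω ^ 2 ∂P = _ := (φ.partial_integral_properties T φ.n).2.2.2
  rw [h4, ENNReal.ofReal_sum_of_nonneg fun i _ =>
    mul_nonneg (hnn i) (integral_nonneg fun ω => sq_nonneg _)]
  have hin : ∀ ω, ∫⁻ s in Set.Icc (0 : ℝ) T, ‖φ.eval s.toNNReal ω‖ₑ ^ 2 =
      ∑ i ∈ Finset.range φ.n, ‖φ.ξ i ω‖ₑ ^ 2 *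
        ENNReal.ofReal ((min (φ.t (i + 1)) T : ℝ≥0) - (min (φ.t i) T : ℝ≥0)) := fun ω => by
    simp only [eval, enorm_sum_indicator_sq φ.mono (fun i => φ.ξ i ω)]
    rw [lintegral_finsetSum]
    · simp only [lintegral_indicator_Ioc_toNNReal]
    · exact fun i _ => (measurable_const.indicator measurableSet_Ioc).comp measurable_real_toNNReal
  have hm : ∀ i, AEMeasurable (fun ω => ‖φ.ξ i ω‖ₑ ^ 2) P := fun i =>
    (φ.memLp_coeff i).aestronglyMeasurable.enorm.pow_const 2
  simp only [energy, hin]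
  rw [lintegral_finsetSum' _ fun i _ => (hm i).mul_const _]
  refine Finset.sum_congr rfl fun i _ => ?_
  rw [lintegral_mul_const'' _ (hm i), hsq _ (φ.memLp_coeff i), ENNReal.ofReal_mul (hnn i), mul_comm]

end SimpleProcess

end SimpleIntegral

section ItoIntegral

variable {Ω : Type*} {mΩ : MeasurableSpace Ω} {P : Measure Ω} {W : ℝ≥0 → Ω → ℝ}

/-- A process as a function on the product space, with real time. -/
def uncurried (φ : ℝ≥0 → Ω → ℝ) (p : Ω × ℝ) : ℝ := φ p.2.toNNReal p.1

theorem energy_eq_eLpNorm_sq [SFinite P] {T : ℝ≥0} {φ : ℝ≥0 → Ω → ℝ}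
    (hφ : AEStronglyMeasurable (uncurried φ) (P.prod (volume.restrict (Set.Icc (0 : ℝ) T)))) :
    energy P T φ = eLpNorm (uncurried φ) 2 (P.prod (volume.restrict (Set.Icc (0 : ℝ) T))) ^ 2 := by
  have hL : eLpNorm (uncurried φ) 2 (P.prod (volume.restrict (Set.Icc (0 : ℝ) T))) ^ 2 =
      ∫⁻ p, ‖uncurried φ p‖ₑ ^ 2 ∂(P.prod (volume.restrict (Set.Icc (0 : ℝ) T))) := by
    simpa using eLpNorm_nnreal_pow_eq_lintegral (f := uncurried φ)
      (μ := P.prod (volume.restrict (Set.Icc (0 : ℝ) T))) (p := 2) two_ne_zero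
  rw [hL, lintegral_prod _ (hφ.enorm.pow_const 2)]
  rfl

theorem aestronglyMeasurable_uncurried [SFinite P] {F : Filtration ℝ≥0 mΩ} {φ : ℝ≥0 → Ω → ℝ}
    (hφ : IsStronglyProgressive F φ) (T : ℝ≥0) :
    AEStronglyMeasurable (uncurried φ) (P.prod (volume.restrict (Set.Icc (0 : ℝ) T))) := by
  have h1 : StronglyMeasurable fun p : Set.Iic T × Ω => φ p.1 p.2 :=
    (hφ T).mono (sup_le_sup le_rfl (MeasurableSpace.comap_mono (F.le T)))
  have h2 : Measurable fun p : Ω × ℝ => 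
      ((⟨min p.2.toNNReal T, Set.mem_Iic.2 (min_le_right _ _)⟩ : Set.Iic T), p.1) :=
    (Measurable.subtype_mk ((measurable_real_toNNReal.comp measurable_snd).min
      measurable_const)).prodMk measurable_fst
  refine ⟨_, h1.comp_measurable h2, ?_⟩
  have h3 : ∀ᵐ p : Ω × ℝ ∂(P.prod (volume.restrict (Set.Icc (0 : ℝ) T))),
      p.2 ∈ Set.Icc (0 : ℝ) T :=
    Measure.quasiMeasurePreserving_snd.ae (ae_restrict_mem measurableSet_Icc)
  filter_upwards [h3] with p hp
  simp only [uncurried, Function.comp_apply]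
  rw [min_eq_left (Real.toNNReal_le_iff_le_coe.2 hp.2)]

theorem SimpleProcess.measurable_uncurried_eval {F : Filtration ℝ≥0 mΩ} (φ : SimpleProcess F) :
    Measurable (uncurried φ.eval) := by
  unfold uncurried SimpleProcess.eval
  refine Finset.measurable_fun_sum _ fun i _ => ?_
  have h : Measurable fun p : Ω × ℝ => φ.ξ i p.1 :=
    ((φ.measurable i).mono (F.le _)).measurable.comp measurable_fst
  exact h.indicator ((measurable_real_toNNReal.comp measurable_snd) measurableSet_Ioc)

variable [P.IsComplete] [IsProbabilityMeasure P] {hW : IsBrownianReal W P}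

theorem IsItoIntegral.eLpNorm_le {u : ℝ≥0 → Ω → ℝ} {T : ℝ≥0} {I : Ω → ℝ}
    (h : IsItoIntegral (augmentedFiltration P W hW) P W u T I)
    (hu : AEStronglyMeasurable (uncurried u) (P.prod (volume.restrict (Set.Icc (0 : ℝ) T)))) :
    eLpNorm I 2 P ≤ eLpNorm (uncurried u) 2 (P.prod (volume.restrict (Set.Icc (0 : ℝ) T))) := by
  obtain ⟨hI, φ, h1, h2⟩ := h
  set μ := P.prod (volume.restrict (Set.Icc (0 : ℝ) T))
  have hm : ∀ k, AEStronglyMeasurable (uncurried (φ k).eval) μ := fun k =>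
    (φ k).measurable_uncurried_eval.aestronglyMeasurable
  have h3 : ∀ k, energy P T (fun s ω => (φ k).eval s ω - u s ω) =
      eLpNorm (uncurried (φ k).eval - uncurried u) 2 μ ^ 2 := fun k =>
    energy_eq_eLpNorm_sq ((hm k).sub hu)
  have h4 : Tendsto (fun k => eLpNorm (uncurried (φ k).eval - uncurried u) 2 μ) atTop (𝓝 0) := by
    simp only [h3] at h1
    have := ((ENNReal.continuous_rpow_const (y := 2⁻¹)).tendsto 0).comp h1
    have e : ∀ x : ℝ≥0∞, (x ^ 2) ^ (2⁻¹ : ℝ) = x := fun x => by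
      rw [← ENNReal.rpow_natCast, ← ENNReal.rpow_mul]; norm_num
    simpa [Function.comp_def, e] using this
  have h5 : ∀ k, eLpNorm ((φ k).integral W T) 2 P = eLpNorm (uncurried (φ k).eval) 2 μ := fun k =>
    (ENNReal.pow_right_strictMono two_ne_zero).injective <|
      ((φ k).energy_eval T).symm.trans (energy_eq_eLpNorm_sq (hm k))
  have hlim := (h2.add h4).add_const (eLpNorm (uncurried u) 2 μ)
  simp only [zero_add] at hlim
  refine ge_of_tendsto' hlim fun k => ?_
  have e1 : I = (φ k).integral W T - ((φ k).integral W T - I) := by simp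
  have e2 : uncurried (φ k).eval = (uncurried (φ k).eval - uncurried u) + uncurried u := by simp
  have hS := ((φ k).memLp_integral T).aestronglyMeasurable
  calc eLpNorm I 2 P
      ≤ eLpNorm ((φ k).integral W T) 2 P + eLpNorm ((φ k).integral W T - I) 2 P := by
        conv_lhs => rw [e1]
        exact eLpNorm_sub_le hS (hS.sub hI.aestronglyMeasurable) one_le_two
    _ ≤ (eLpNorm (uncurried (φ k).eval - uncurried u) 2 μ + eLpNorm (uncurried u) 2 μ) +
          eLpNorm ((φ k).integral W T - I) 2 P := by
        gcongr
        rw [h5]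
        conv_lhs => rw [e2]
        exact eLpNorm_add_le ((hm k).sub hu) hu one_le_two
    _ = _ := by
        rw [add_comm, ← add_assoc]; rfl

theorem IsItoIntegral.integral_eq_zero {u : ℝ≥0 → Ω → ℝ} {T : ℝ≥0} {I : Ω → ℝ}
    (h : IsItoIntegral (augmentedFiltration P W hW) P W u T I) : ∫ ω, I ω ∂P = 0 := by
  obtain ⟨hI, φ, -, h2⟩ := h
  have hS := fun k => (φ k).memLp_integral T
  have h3 : Tendsto (fun k => eLpNorm ((φ k).integral W T - I) 1 P) atTop (𝓝 0) :=
    tendsto_of_tendsto_of_tendsto_of_le_of_le tendsto_const_nhds h2 (fun _ => zero_le)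
      fun k => eLpNorm_le_eLpNorm_of_exponent_le one_le_two
        ((hS k).sub hI).aestronglyMeasurable
  have h4 := tendsto_integral_of_L1' I (hI.integrable one_le_two).aestronglyMeasurable
    (Eventually.of_forall fun k => (hS k).integrable one_le_two) h3
  simp only [SimpleProcess.integral_integral_eq_zero] at h4
  exact (tendsto_nhds_unique h4 tendsto_const_nhds)

theorem itoIntegral_properties {u : ℝ≥0 → Ω → ℝ} {T : ℝ≥0}
    (hu : AEStronglyMeasurable (uncurried u) (P.prod (volume.restrict (Set.Icc (0 : ℝ) T)))) :
    let I := itoIntegral (augmentedFiltration P W hW) P W u T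
    MemLp I 2 P ∧ ∫ ω, I ω ∂P = 0 ∧
      eLpNorm I 2 P ≤ eLpNorm (uncurried u) 2 (P.prod (volume.restrict (Set.Icc (0 : ℝ) T))) := by
  intro I
  by_cases h : ∃ I : Ω → ℝ, IsItoIntegral (augmentedFiltration P W hW) P W u T I
  · have hI : I = h.choose := dif_pos h
    rw [hI]
    exact ⟨h.choose_spec.1, h.choose_spec.integral_eq_zero, h.choose_spec.eLpNorm_le hu⟩
  · have hI : I = 0 := dif_neg h
    rw [hI]
    exact ⟨MemLp.zero, by simp, by simp⟩

end ItoIntegral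

section UnitInterval

/-- Lebesgue measure on the unit interval. -/
noncomputable abbrev unitMeasure : Measure ℝ := volume.restrict (Set.Ioc 0 1)

instance : IsProbabilityMeasure unitMeasure := ⟨by simp [unitMeasure]⟩

theorem sq_integral_le_integral_sq {f : ℝ → ℝ} (hf : MemLp f 2 unitMeasure) :
    (∫ t, f t ∂unitMeasure) ^ 2 ≤ ∫ t, f t ^ 2 ∂unitMeasure := by
  have h := variance_nonneg f unitMeasure
  rw [variance_eq_sub hf] at h
  simpa using h

theorem integrable_sq_mul_sq {f : ℝ → ℝ} (hf : MemLp f 2 unitMeasure) :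
    Integrable (fun t => t ^ 2 * |f t| ^ 2) unitMeasure := by
  have h := hf.integrable_sq
  refine h.mono' ((by fun_prop : Measurable fun t : ℝ => t ^ 2).aestronglyMeasurable.mul
    (by simpa using h.aestronglyMeasurable)) ?_
  filter_upwards [ae_restrict_mem measurableSet_Ioc] with t ht
  rw [Real.norm_of_nonneg (by positivity), sq_abs]
  exact mul_le_of_le_one_left (sq_nonneg _) (pow_le_one₀ ht.1.le ht.2)

/-- The deterministic perturbation `t⁻² 1_{(h, ∞)}`. -/
noncomputable def truncInvSq (h : ℝ) (t : ℝ≥0) : ℝ :=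
  (Set.Ioi h).indicator (fun s => (s ^ 2)⁻¹) (t : ℝ)

theorem measurable_truncInvSq (h : ℝ) : Measurable (truncInvSq h) :=
  ((by fun_prop : Measurable fun s : ℝ => (s ^ 2)⁻¹).indicator measurableSet_Ioi).comp
    measurable_coe_nnreal_real

theorem abs_truncInvSq_le {h : ℝ} (hh : 0 < h) (t : ℝ≥0) : |truncInvSq h t| ≤ (h ^ 2)⁻¹ := by
  unfold truncInvSq
  by_cases ht : (t : ℝ) ∈ Set.Ioi h
  · rw [Set.indicator_of_mem ht, abs_of_nonneg (by positivity)]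
    have : h < t := ht
    gcongr
  · rw [Set.indicator_of_notMem ht, abs_zero]
    positivity

theorem sq_mul_truncInvSq {h : ℝ} (hh : 0 < h) (t : ℝ≥0) (a : ℝ) :
    (t : ℝ) ^ 2 * (truncInvSq h t * a) = (Set.Ioi h).indicator (fun _ => a) (t : ℝ) := by
  unfold truncInvSq
  by_cases ht : (t : ℝ) ∈ Set.Ioi h
  · rw [Set.indicator_of_mem ht, Set.indicator_of_mem ht]
    have : (t : ℝ) ≠ 0 := (hh.trans ht).ne'
    field_simp
  · simp [Set.indicator_of_notMem ht]

theorem integral_truncInvSq {h : ℝ} (hh : 0 < h) (hh1 : h ≤ 1) :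
    ∫ t, truncInvSq h t.toNNReal ∂unitMeasure = h⁻¹ - 1 := by
  have e : ∫ t, truncInvSq h t.toNNReal ∂unitMeasure =
      ∫ t in Set.Ioc 0 1, (Set.Ioi h).indicator (fun s : ℝ => (s ^ 2)⁻¹) t := by
    refine setIntegral_congr_fun measurableSet_Ioc fun t ht => ?_
    simp only [truncInvSq, Real.coe_toNNReal t ht.1.le]
  have hset : Set.Ioc (0 : ℝ) 1 ∩ Set.Ioi h = Set.Ioc h 1 := by
    ext t
    simp only [Set.mem_inter_iff, Set.mem_Ioc, Set.mem_Ioi]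
    constructor
    · rintro ⟨⟨_, h2⟩, h3⟩; exact ⟨h3, h2⟩
    · rintro ⟨h1, h2⟩; exact ⟨⟨hh.trans h1, h2⟩, h1⟩
  rw [e, setIntegral_indicator measurableSet_Ioi, hset, ← intervalIntegral.integral_of_le hh1]
  have hpos : ∀ t ∈ Set.uIcc h 1, t ≠ 0 := fun t ht => by
    rw [Set.uIcc_of_le hh1] at ht
    exact (hh.trans_le ht.1).ne'
  have hcont : ContinuousOn (fun t : ℝ => (t ^ 2)⁻¹) (Set.uIcc h 1) :=
    (continuousOn_id.pow 2).inv₀ fun t ht => pow_ne_zero 2 (hpos t ht)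
  rw [intervalIntegral.integral_eq_sub_of_hasDerivAt (f := fun t : ℝ => -t⁻¹)
    (fun t ht => by simpa using (hasDerivAt_inv (hpos t ht)).fun_neg) hcont.intervalIntegrable]
  simp
  ring

theorem integral_perturbed_running_cost {f g : ℝ → ℝ} (hf : MemLp f 2 unitMeasure)
    (hg : MemLp g 2 unitMeasure) {h : ℝ} (hh : 0 < h) (ε : ℝ) :
    ∫ t, (t ^ 2 * |f t + ε * truncInvSq h t.toNNReal| ^ 2 - |g t| ^ 2) ∂unitMeasure =
      (∫ t, (t ^ 2 * |f t| ^ 2 - |g t| ^ 2) ∂unitMeasure) +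
        2 * ε * (∫ t, (Set.Ioi h).indicator f t ∂unitMeasure) +
        ε ^ 2 * ∫ t, truncInvSq h t.toNNReal ∂unitMeasure := by
  have i1 : Integrable (fun t => t ^ 2 * |f t| ^ 2 - |g t| ^ 2) unitMeasure :=
    (integrable_sq_mul_sq hf).sub (by simpa using hg.integrable_sq)
  have i2 : Integrable (fun t => 2 * ε * (Set.Ioi h).indicator f t) unitMeasure :=
    ((hf.integrable one_le_two).indicator measurableSet_Ioi).const_mul _
  have i3 : Integrable (fun t => ε ^ 2 * truncInvSq h t.toNNReal) unitMeasure :=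
    (Integrable.of_bound ((measurable_truncInvSq h).comp
      measurable_real_toNNReal).aestronglyMeasurable _
      (ae_of_all _ fun t => abs_truncInvSq_le hh _)).const_mul _
  have i12 : Integrable (fun t => t ^ 2 * |f t| ^ 2 - |g t| ^ 2 +
      2 * ε * (Set.Ioi h).indicator f t) unitMeasure := i1.add i2
  rw [← integral_const_mul, ← integral_const_mul, ← integral_add i1 i2, ← integral_add i12 i3]
  refine setIntegral_congr_fun measurableSet_Ioc fun t ht => ?_
  have h1 := sq_mul_truncInvSq hh t.toNNReal (f t)
  have h2 := sq_mul_truncInvSq hh t.toNNReal (truncInvSq h t.toNNReal)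
  rw [Real.coe_toNNReal t ht.1.le] at h1 h2
  have h3 : (Set.Ioi h).indicator (fun _ => truncInvSq h t.toNNReal) t =
      truncInvSq h t.toNNReal := by
    by_cases hm : t ∈ Set.Ioi h <;> simp [hm, truncInvSq, Real.coe_toNNReal t ht.1.le]
  have h4 : (Set.Ioi h).indicator (fun _ => f t) t = (Set.Ioi h).indicator f t := rfl
  rw [h3] at h2
  rw [h4] at h1
  simp only [sq_abs]
  linear_combination 2 * ε * h1 + ε ^ 2 * h2

end UnitInterval

section Controls

variable {Ω : Type*} {mΩ : MeasurableSpace Ω} {P : Measure Ω}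

theorem integrable_running_cost {U V : Ω × ℝ → ℝ} (hU : MemLp U 2 (P.prod unitMeasure))
    (hV : MemLp V 2 (P.prod unitMeasure)) :
    Integrable (fun ω => ∫ t, (t ^ 2 * |U (ω, t)| ^ 2 - |V (ω, t)| ^ 2) ∂unitMeasure) P := by
  have hsq := hU.integrable_sq
  have h1 : Integrable (fun p : Ω × ℝ => p.2 ^ 2 * |U p| ^ 2) (P.prod unitMeasure) := by
    refine hsq.mono' ((by fun_prop : Measurable fun p : Ω × ℝ => p.2 ^ 2).aestronglyMeasurable.mul
      (by simpa using hsq.aestronglyMeasurable)) ?_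
    have h3 : ∀ᵐ p : Ω × ℝ ∂(P.prod unitMeasure), p.2 ∈ Set.Ioc (0 : ℝ) 1 :=
      Measure.quasiMeasurePreserving_snd.ae (ae_restrict_mem measurableSet_Ioc)
    filter_upwards [h3] with p hp
    rw [Real.norm_of_nonneg (by positivity), sq_abs]
    exact mul_le_of_le_one_left (sq_nonneg _) (pow_le_one₀ hp.1.le hp.2)
  have h2 : Integrable (fun p : Ω × ℝ => p.2 ^ 2 * |U p| ^ 2 - |V p| ^ 2) (P.prod unitMeasure) :=
    h1.sub (by simpa using hV.integrable_sq)
  exact h2.integral_prod_left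

variable [IsProbabilityMeasure P]

theorem restrict_Icc_eq_unitMeasure :
    volume.restrict (Set.Icc (0 : ℝ) (1 : ℝ≥0)) = unitMeasure := by
  rw [NNReal.coe_one]
  exact (Measure.restrict_congr_set Ioc_ae_eq_Icc).symm

theorem mem_controls_one_iff {F : Filtration ℝ≥0 mΩ} {u : ℝ≥0 → Ω → ℝ} :
    u ∈ controls F P 1 ↔
      IsStronglyProgressive F u ∧ MemLp (uncurried u) 2 (P.prod unitMeasure) := by
  refine and_congr_right fun hp => ?_
  have hm := aestronglyMeasurable_uncurried (P := P) hp 1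
  rw [energy_eq_eLpNorm_sq hm]
  rw [restrict_Icc_eq_unitMeasure] at hm ⊢
  exact ⟨fun h => ⟨hm, by simpa using h⟩, fun h => by simpa using h.2⟩

theorem isStronglyProgressive_deterministic (F : Filtration ℝ≥0 mΩ) {v : ℝ≥0 → ℝ}
    (hv : Measurable v) : IsStronglyProgressive F fun t _ => v t := fun i =>
  hv.stronglyMeasurable.comp_measurable
    (measurable_subtype_coe.comp (@measurable_fst (Set.Iic i) Ω _ (F i)))

theorem add_truncInvSq_mem_controls {F : Filtration ℝ≥0 mΩ} {u : ℝ≥0 → Ω → ℝ}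
    (hu : u ∈ controls F P 1) {h : ℝ} (hh : 0 < h) (ε : ℝ) :
    (fun t ω => u t ω + ε * truncInvSq h t) ∈ controls F P 1 := by
  rw [mem_controls_one_iff] at hu ⊢
  have hm := (measurable_truncInvSq h).const_mul ε
  refine ⟨hu.1.add (isStronglyProgressive_deterministic F hm), hu.2.add ?_⟩
  refine MemLp.of_bound (hm.comp
    (measurable_real_toNNReal.comp measurable_snd)).aestronglyMeasurable
    (|ε| * (h ^ 2)⁻¹) (ae_of_all _ fun p => ?_)
  simp only [Real.norm_eq_abs, abs_mul]
  gcongr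
  exact abs_truncInvSq_le hh _

theorem zero_mem_controls (F : Filtration ℝ≥0 mΩ) : (0 : ℝ≥0 → Ω → ℝ) ∈ controls F P 1 :=
  mem_controls_one_iff.2 ⟨isStronglyProgressive_const F 0, MemLp.zero⟩

theorem ae_memLp_section {U : Ω × ℝ → ℝ} (hU : MemLp U 2 (P.prod unitMeasure)) :
    ∀ᵐ ω ∂P, MemLp (fun t => U (ω, t)) 2 unitMeasure := by
  filter_upwards [hU.aestronglyMeasurable.prodMk_left, hU.integrable_sq.prod_right_ae]
    with ω h1 h2
  exact (memLp_two_iff_integrable_sq h1).2 h2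

theorem memLp_drift {U : Ω × ℝ → ℝ} (hU : MemLp U 2 (P.prod unitMeasure)) :
    MemLp (fun ω => ∫ t, U (ω, t) ∂unitMeasure) 2 P := by
  have hm := hU.aestronglyMeasurable.integral_prod_right'
  rw [memLp_two_iff_integrable_sq hm]
  refine hU.integrable_sq.integral_prod_left.mono' (hm.pow 2) ?_
  filter_upwards [ae_memLp_section hU] with ω hω
  rw [Real.norm_of_nonneg (sq_nonneg _)]
  exact sq_integral_le_integral_sq hω

end Controls

section Game

variable {Ω : Type*} {mΩ : MeasurableSpace Ω} {P : Measure Ω} [P.IsComplete]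
  {W : ℝ≥0 → Ω → ℝ} {hW : IsBrownianReal W P}

theorem lowerValue_le_upperValue (x : ℝ) : lowerValue P W hW x ≤ upperValue P W hW x :=
  iSup₂_le fun u₂ h₂ => le_iInf₂ fun u₁ h₁ =>
    iInf₂_le_of_le u₁ h₁ (le_iSup₂_of_le u₂ h₂ le_rfl)

theorem state_one_eq (x : ℝ) (u₁ u₂ : ℝ≥0 → Ω → ℝ) (ω : Ω) :
    state (augmentedFiltration P W hW) P W x u₁ u₂ 1 ω =
      x + (∫ t, uncurried u₁ (ω, t) ∂unitMeasure) +
        itoIntegral (augmentedFiltration P W hW) P W u₂ 1 ω := by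
  rw [state, NNReal.coe_one, intervalIntegral.integral_of_le zero_le_one]
  rfl

theorem cost_eq (x : ℝ) (u₁ u₂ : ℝ≥0 → Ω → ℝ) :
    cost P W hW x u₁ u₂ = ∫ ω, (state (augmentedFiltration P W hW) P W x u₁ u₂ 1 ω ^ 2 +
      ∫ t, (t ^ 2 * |uncurried u₁ (ω, t)| ^ 2 - |uncurried u₂ (ω, t)| ^ 2) ∂unitMeasure) ∂P := by
  simp only [cost, sq_abs, intervalIntegral.integral_of_le zero_le_one]
  rfl

theorem cost_zero_right_nonneg (x : ℝ) (u₁ : ℝ≥0 → Ω → ℝ) : 0 ≤ cost P W hW x u₁ 0 := by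
  rw [cost_eq]
  refine integral_nonneg fun ω => add_nonneg (sq_nonneg _) (integral_nonneg fun t => ?_)
  simp only [uncurried, Pi.zero_apply, abs_zero, ne_eq, OfNat.ofNat_ne_zero, not_false_eq_true,
    zero_pow, sub_zero]
  positivity

variable [IsProbabilityMeasure P]

theorem itoIntegral_one_properties {u : ℝ≥0 → Ω → ℝ} (hu : u ∈ controlSpace P W hW) :
    let I := itoIntegral (augmentedFiltration P W hW) P W u 1
    MemLp I 2 P ∧ ∫ ω, I ω ∂P = 0 ∧
      eLpNorm I 2 P ≤ eLpNorm (uncurried u) 2 (P.prod unitMeasure) := by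
  have h := itoIntegral_properties (hW := hW) (aestronglyMeasurable_uncurried (P := P) hu.1 1)
  rwa [restrict_Icc_eq_unitMeasure] at h

theorem memLp_state_one (x : ℝ) {u₁ u₂ : ℝ≥0 → Ω → ℝ} (h₁ : u₁ ∈ controlSpace P W hW)
    (h₂ : u₂ ∈ controlSpace P W hW) :
    MemLp (state (augmentedFiltration P W hW) P W x u₁ u₂ 1) 2 P := by
  have e : state (augmentedFiltration P W hW) P W x u₁ u₂ 1 = fun ω =>
      x + (∫ t, uncurried u₁ (ω, t) ∂unitMeasure) +
        itoIntegral (augmentedFiltration P W hW) P W u₂ 1 ω := funext (state_one_eq x u₁ u₂)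
  rw [e]
  exact ((memLp_const x).add (memLp_drift (mem_controls_one_iff.1 h₁).2)).add
    (itoIntegral_one_properties h₂).1

theorem integral_state_one (x : ℝ) {u₁ u₂ : ℝ≥0 → Ω → ℝ} (h₁ : u₁ ∈ controlSpace P W hW)
    (h₂ : u₂ ∈ controlSpace P W hW) :
    ∫ ω, state (augmentedFiltration P W hW) P W x u₁ u₂ 1 ω ∂P =
      x + ∫ p, uncurried u₁ p ∂(P.prod unitMeasure) := by
  obtain ⟨hI, hI0, -⟩ := itoIntegral_one_properties h₂
  have hU := (mem_controls_one_iff.1 h₁).2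
  have hA := (memLp_drift hU).integrable one_le_two
  have hxA : Integrable (fun ω => x + ∫ t, uncurried u₁ (ω, t) ∂unitMeasure) P :=
    (integrable_const x).add hA
  simp only [state_one_eq]
  rw [integral_add hxA (hI.integrable one_le_two), integral_add (integrable_const x) hA, hI0,
    integral_prod _ (hU.integrable one_le_two)]
  simp

theorem cost_zero_left_le (x : ℝ) {u₂ : ℝ≥0 → Ω → ℝ} (h₂ : u₂ ∈ controlSpace P W hW) :
    cost P W hW x 0 u₂ ≤ x ^ 2 := by
  obtain ⟨hI, hI0, hIle⟩ := itoIntegral_one_properties h₂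
  have hU := (mem_controls_one_iff.1 h₂).2
  set I := itoIntegral (augmentedFiltration P W hW) P W u₂ 1
  have hsq : ∫ ω, I ω ^ 2 ∂P ≤ ∫ p, uncurried u₂ p ^ 2 ∂(P.prod unitMeasure) := by
    have h1 := hI.eLpNorm_eq_integral_rpow_norm two_ne_zero ENNReal.ofNat_ne_top
    have h2 := hU.eLpNorm_eq_integral_rpow_norm two_ne_zero ENNReal.ofNat_ne_top
    rw [h1, h2] at hIle
    simp only [ENNReal.toReal_ofNat, Real.rpow_ofNat, Real.norm_eq_abs, sq_abs] at hIle
    rw [ENNReal.ofReal_le_ofReal_iff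
      (Real.rpow_nonneg (integral_nonneg fun p => sq_nonneg _) _)] at hIle
    exact (Real.rpow_le_rpow_iff (integral_nonneg fun p => sq_nonneg _)
      (integral_nonneg fun p => sq_nonneg _) (by norm_num)).1 hIle
  have e : ∀ ω, state (augmentedFiltration P W hW) P W x 0 u₂ 1 ω ^ 2 +
      ∫ t, (t ^ 2 * |uncurried (0 : ℝ≥0 → Ω → ℝ) (ω, t)| ^ 2 - |uncurried u₂ (ω, t)| ^ 2)
        ∂unitMeasure =
      x ^ 2 + 2 * x * I ω + I ω ^ 2 - ∫ t, uncurried u₂ (ω, t) ^ 2 ∂unitMeasure := fun ω => by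
    rw [state_one_eq]
    simp only [uncurried, Pi.zero_apply, abs_zero, integral_zero, sq_abs, zero_sub, ne_eq,
      OfNat.ofNat_ne_zero, not_false_eq_true, zero_pow, mul_zero, integral_neg, add_zero]
    ring
  have i1 : Integrable (fun ω => 2 * x * I ω) P := (hI.integrable one_le_two).const_mul _
  have i2 : Integrable (fun ω => x ^ 2 + 2 * x * I ω) P := (integrable_const _).add i1
  have i3 : Integrable (fun ω => x ^ 2 + 2 * x * I ω + I ω ^ 2) P := i2.add hI.integrable_sq
  rw [cost_eq]
  simp only [e]
  rw [integral_sub i3 hU.integrable_sq.integral_prod_left, integral_add i2 hI.integrable_sq,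
    integral_add (integrable_const _) i1, integral_const_mul, hI0,
    ← integral_prod _ hU.integrable_sq]
  simp only [integral_const, probReal_univ, one_smul]
  linarith

theorem cost_add_truncInvSq (x : ℝ) {u₁ u₂ : ℝ≥0 → Ω → ℝ} (h₁ : u₁ ∈ controlSpace P W hW)
    (h₂ : u₂ ∈ controlSpace P W hW) {h : ℝ} (hh : 0 < h) (hh1 : h ≤ 1) (ε : ℝ) :
    cost P W hW x (fun t ω => u₁ t ω + ε * truncInvSq h t) u₂ = cost P W hW x u₁ u₂ +
      ε * (2 * ((h⁻¹ - 1) * (x + ∫ p, uncurried u₁ p ∂(P.prod unitMeasure)) +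
        ∫ p, (Prod.snd ⁻¹' Set.Ioi h).indicator (uncurried u₁) p ∂(P.prod unitMeasure))) +
      ε ^ 2 * ((h⁻¹ - 1) ^ 2 + (h⁻¹ - 1)) := by
  have hU := (mem_controls_one_iff.1 h₁).2
  have hV := (mem_controls_one_iff.1 h₂).2
  have hX := memLp_state_one x h₁ h₂
  have hB : Integrable ((Prod.snd ⁻¹' Set.Ioi h).indicator (uncurried u₁)) (P.prod unitMeasure) :=
    (hU.integrable one_le_two).indicator (measurable_snd measurableSet_Ioi)
  set X := state (augmentedFiltration P W hW) P W x u₁ u₂ 1 with hXdef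
  set R := fun ω => ∫ t, (t ^ 2 * |uncurried u₁ (ω, t)| ^ 2 - |uncurried u₂ (ω, t)| ^ 2)
    ∂unitMeasure with hRdef
  set B := fun ω => ∫ t, (Prod.snd ⁻¹' Set.Ioi h).indicator (uncurried u₁) (ω, t) ∂unitMeasure
    with hBdef
  have hR : Integrable R P := integrable_running_cost hU hV
  have hBi : Integrable B P := hB.integral_prod_left
  have e : ∀ᵐ ω ∂P, state (augmentedFiltration P W hW) P W x
        (fun t ω => u₁ t ω + ε * truncInvSq h t) u₂ 1 ω ^ 2 +
      ∫ t, (t ^ 2 * |uncurried (fun t ω => u₁ t ω + ε * truncInvSq h t) (ω, t)| ^ 2 -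
        |uncurried u₂ (ω, t)| ^ 2) ∂unitMeasure =
      (X ω ^ 2 + R ω) + ε * (2 * ((h⁻¹ - 1) * X ω + B ω)) +
        ε ^ 2 * ((h⁻¹ - 1) ^ 2 + (h⁻¹ - 1)) := by
    filter_upwards [ae_memLp_section hU, ae_memLp_section hV] with ω hf hg
    have hv : Integrable (fun t : ℝ => ε * truncInvSq h t.toNNReal) unitMeasure :=
      (Integrable.of_bound ((measurable_truncInvSq h).comp
        measurable_real_toNNReal).aestronglyMeasurable _
        (ae_of_all _ fun t => abs_truncInvSq_le hh _)).const_mul _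
    have h3 : ∫ t, uncurried (fun t ω => u₁ t ω + ε * truncInvSq h t) (ω, t) ∂unitMeasure =
        (∫ t, uncurried u₁ (ω, t) ∂unitMeasure) + ε * (h⁻¹ - 1) := by
      rw [← integral_truncInvSq hh hh1, ← integral_const_mul]
      exact integral_add (hf.integrable one_le_two) hv
    have h4 := integral_perturbed_running_cost hf hg hh ε
    rw [integral_truncInvSq hh hh1] at h4
    have h5 : ∫ t, (t ^ 2 * |uncurried (fun t ω => u₁ t ω + ε * truncInvSq h t) (ω, t)| ^ 2 -
        |uncurried u₂ (ω, t)| ^ 2) ∂unitMeasure =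
        R ω + 2 * ε * B ω + ε ^ 2 * (h⁻¹ - 1) := h4
    rw [h5, hXdef, state_one_eq, state_one_eq, h3]
    ring
  have i1 : Integrable (fun ω => X ω ^ 2 + R ω) P := hX.integrable_sq.add hR
  have i2 : Integrable (fun ω => (h⁻¹ - 1) * X ω) P := (hX.integrable one_le_two).const_mul _
  have i3 : Integrable (fun ω => ε * (2 * ((h⁻¹ - 1) * X ω + B ω))) P :=
    ((i2.add hBi).const_mul 2).const_mul ε
  have i4 : Integrable (fun ω => (X ω ^ 2 + R ω) + ε * (2 * ((h⁻¹ - 1) * X ω + B ω))) P :=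
    i1.add i3
  rw [cost_eq, cost_eq, integral_congr_ae e, integral_add i4 (integrable_const _),
    integral_add i1 i3, integral_const_mul, integral_const_mul, integral_add i2 hBi,
    integral_const_mul, integral_state_one x h₁ h₂, ← integral_prod _ hB]
  simp only [integral_const, probReal_univ, one_smul]
  rfl

theorem eq_zero_of_forall_nonneg_quadratic {c d : ℝ} (h : ∀ ε : ℝ, 0 ≤ ε * c + ε ^ 2 * d) :
    c = 0 := by
  refine eq_zero_of_abs_le_mul (C := d) one_pos fun δ hδ _ => abs_le.2 ⟨?_, ?_⟩
  · have := h δ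
    have h2 : 0 ≤ δ * (c + δ * d) := by linarith
    linarith [nonneg_of_mul_nonneg_right h2 hδ]
  · have := h (-δ)
    have h2 : 0 ≤ δ * (δ * d - c) := by linarith
    linarith [nonneg_of_mul_nonneg_right h2 hδ]

theorem not_exists_minimizer {x : ℝ} (hx : x ≠ 0) {u₁ u₂ : ℝ≥0 → Ω → ℝ}
    (h₁ : u₁ ∈ controlSpace P W hW) (h₂ : u₂ ∈ controlSpace P W hW) :
    ∃ v ∈ controlSpace P W hW, cost P W hW x v u₂ < cost P W hW x u₁ u₂ := by
  by_contra! hmin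
  have hU := ((mem_controls_one_iff.1 h₁).2).integrable one_le_two
  set a := ∫ p, uncurried u₁ p ∂(P.prod unitMeasure) with ha
  set b := fun n : ℕ => ∫ p, (Prod.snd ⁻¹' Set.Ioi (1 / ((n : ℝ) + 1))).indicator (uncurried u₁) p
    ∂(P.prod unitMeasure) with hb
  have hfoc : ∀ n : ℕ, n * (x + a) + b n = 0 := fun n => by
    have hh : 0 < 1 / ((n : ℝ) + 1) := by positivity
    have hh1 : 1 / ((n : ℝ) + 1) ≤ 1 := by
      rw [div_le_one (by positivity)]
      linarith [n.cast_nonneg (α := ℝ)]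
    have h3 := eq_zero_of_forall_nonneg_quadratic fun ε => by
      have := hmin _ (add_truncInvSq_mem_controls h₁ hh ε)
      rw [cost_add_truncInvSq x h₁ h₂ hh hh1, add_assoc] at this
      exact (le_add_iff_nonneg_right _).1 this
    have h4 : (1 / ((n : ℝ) + 1))⁻¹ - 1 = n := by simp
    rw [h4] at h3
    linarith
  have hlim : Tendsto b atTop (𝓝 a) := by
    refine tendsto_integral_of_dominated_convergence (fun p => ‖uncurried u₁ p‖)
      (fun n => (hU.indicator (measurable_snd measurableSet_Ioi)).aestronglyMeasurable) hU.norm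
      (fun n => ae_of_all _ fun p => norm_indicator_le_norm_self _ _) ?_
    have h3 : ∀ᵐ p : Ω × ℝ ∂(P.prod unitMeasure), p.2 ∈ Set.Ioc (0 : ℝ) 1 :=
      Measure.quasiMeasurePreserving_snd.ae (ae_restrict_mem measurableSet_Ioc)
    filter_upwards [h3] with p hp
    refine tendsto_const_nhds.congr' ?_
    filter_upwards [(tendsto_one_div_add_atTop_nhds_zero_nat (𝕜 := ℝ)).eventually_lt_const hp.1]
      with n hn
    exact (Set.indicator_of_mem (s := Prod.snd ⁻¹' Set.Ioi (1 / ((n : ℝ) + 1))) hn _).symm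
  have hxa : x + a = 0 := by
    have h5 : Tendsto (fun n : ℕ => -(b n * (n : ℝ)⁻¹)) atTop (𝓝 0) := by
      simpa using (hlim.mul tendsto_inv_atTop_nhds_zero_nat).neg
    refine (tendsto_nhds_unique (h5.congr' ?_) tendsto_const_nhds).symm
    filter_upwards [eventually_gt_atTop 0] with n hn
    have hn' : (n : ℝ) ≠ 0 := by positivity
    field_simp
    linarith [hfoc n]
  have hb0 : ∀ n, b n = 0 := fun n => by simpa [hxa] using hfoc n
  have ha0 : a = 0 := tendsto_nhds_unique hlim (tendsto_const_nhds.congr fun n => (hb0 n).symm)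
  exact hx (by simpa [ha0] using hxa)

theorem not_exists_isOpenLoopSaddlePoint {x : ℝ} (hx : x ≠ 0) :
    ¬ ∃ u₁ u₂, IsOpenLoopSaddlePoint P W hW x u₁ u₂ := by
  rintro ⟨u₁, u₂, h₁, h₂, h⟩
  obtain ⟨v, hv, hlt⟩ := not_exists_minimizer hx h₁ h₂
  exact (h v hv u₂ h₂).2.not_gt hlt

theorem zero_le_lowerValue (x : ℝ) : 0 ≤ lowerValue P W hW x :=
  le_iSup₂_of_le 0 (zero_mem_controls _) <|
    le_iInf₂ fun u₁ _ => EReal.coe_nonneg.2 (cost_zero_right_nonneg x u₁)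

theorem upperValue_le (x : ℝ) : upperValue P W hW x ≤ ((x ^ 2 : ℝ) : EReal) :=
  iInf₂_le_of_le 0 (zero_mem_controls _) <|
    iSup₂_le fun _ h₂ => EReal.coe_le_coe_iff.2 (cost_zero_left_le x h₂)

theorem IsFiniteValue.of_mem_Icc {v : EReal} {a b : ℝ} (ha : (a : EReal) ≤ v) (hb : v ≤ b) :
    IsFiniteValue v :=
  ⟨((EReal.bot_lt_coe a).trans_le ha).ne', (hb.trans_lt (EReal.coe_lt_top b)).ne⟩

theorem values_finite (x : ℝ) :
    IsFiniteValue (lowerValue P W hW x) ∧ IsFiniteValue (upperValue P W hW x) := by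
  have h0 : ((0 : ℝ) : EReal) ≤ lowerValue P W hW x := zero_le_lowerValue x
  have h1 : lowerValue P W hW x ≤ upperValue P W hW x := lowerValue_le_upperValue x
  exact ⟨.of_mem_Icc h0 (h1.trans (upperValue_le x)), .of_mem_Icc (h0.trans h1) (upperValue_le x)⟩

end Game

end SLQGame

theorem mainTheorem11 {Ω : Type*} {mΩ : MeasurableSpace Ω} (P : Measure Ω)
    [IsProbabilityMeasure P] [P.IsComplete] (W : ℝ≥0 → Ω → ℝ) (hW : IsBrownianReal W P) :
    (∀ x : ℝ,
      SLQGame.IsFiniteValue (SLQGame.lowerValue P W hW x) ∧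
      SLQGame.IsFiniteValue (SLQGame.upperValue P W hW x) ∧
      0 ≤ SLQGame.lowerValue P W hW x ∧
      SLQGame.upperValue P W hW x ≤ ((x ^ 2 : ℝ) : EReal)) ∧
    (∀ x : ℝ, x ≠ 0 → ¬ ∃ u₁ u₂, SLQGame.IsOpenLoopSaddlePoint P W hW x u₁ u₂) ∧
    ¬ (∀ x : ℝ,
      SLQGame.IsFiniteValue (SLQGame.lowerValue P W hW x) ∧
        SLQGame.IsFiniteValue (SLQGame.upperValue P W hW x) →
      ∃ u₁ u₂, SLQGame.IsOpenLoopSaddlePoint P W hW x u₁ u₂) := by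
  have hns {x : ℝ} (hx : x ≠ 0) : ¬ ∃ u₁ u₂, SLQGame.IsOpenLoopSaddlePoint P W hW x u₁ u₂ :=
    SLQGame.not_exists_isOpenLoopSaddlePoint hx
  exact ⟨fun x => ⟨(SLQGame.values_finite x).1, (SLQGame.values_finite x).2,
    SLQGame.zero_le_lowerValue x, SLQGame.upperValue_le x⟩, fun _ => hns,
    fun h => hns one_ne_zero (h 1 (SLQGame.values_finite 1))⟩
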